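/- **Stratified spaces.** A compact stratified space is a compact subset $X\subset\mathbb{R}^k$ with a finite decomposition into disjoint connected smooth submanifolds (strata) that satisfies the frontier condition ($S\cap\overline{S'}\neq\emptyset\Rightarrow S\subset\overline{S'}$) and Whitney's condition B; it is cellular if each stratum is contractible. A smooth map $X\to Y$ is a map that extends to a smooth map of the ambient Euclidean spaces. It is *stratified* if the preimage of each stratum $B$ of $Y$ is a union of strata of $X$, each of which is mapped submersively to $B$, and *prestratified* if it becomes stratified after subdividing the stratification of $X$. Let $\mathrm{Strat}_n$ (resp. $\mathrm{Prestrat}_n$) be the category of compact cellular stratified spaces all of whose strata have dimension $\le n$, with morphisms the stratified (resp. prestratified) maps modulo smooth homotopy through such maps, fixed on all strata of the source of dimension $<n$. A sieve on $X$ in $\mathrm{Strat}_n$ is covering if for each stratum $A$ of $X$ it contains (the class of) a stratified map $f:Y\to X$ such that $f^{-1}(A)$ is a single stratum, mapped diffeomorphically to $A$ by $f$. **Whitney categories.** Let $n\in\mathbb{N}$. A *Whitney $n$-category* is a presheaf of sets $\mathcal A$ on $\mathrm{Prestrat}_n$ whose restriction to $\mathrm{Strat}_n$ is a sheaf for the covering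 sieves. A functor of Whitney $n$-categories is a natural transformation. The objects of $\mathcal A$ are the elements of $\mathcal A(\mathrm{pt})$. For $n>0$ and objects $a,a'$ the morphism category $\mathcal A(a,a')$ is the presheaf $$X\mapsto\{\alpha\in\mathcal A(X\times[0,1]) : \iota_0^*\alpha=p^*a,\ \iota_1^*\alpha=p^*a'\}$$ on spaces $X$ of dimension $\le n-1$, where $[0,1]$ is stratified by its end points and its interior, $\iota_t:X\to X\times[0,1]$ is $x\mapsto(x,t)$ and $p:X\to\mathrm{pt}$; maps act by $f\mapsto(f\times\mathrm{id})^*$. A functor $F:\mathcal A\to\mathcal B$ induces $\mathcal A(a,a')\to\mathcal B(Fa,Fa')$. **$n$-equivalence.** A $0$-equivalence is a span $\mathcal A\xleftarrow{F}\mathcal C\xrightarrow{G}\mathcal B$ such that $F(\mathrm{pt})$ and $G(\mathrm{pt})$ are bijective. For $n>0$ an $n$-equivalence is a span $\mathcal A\xleftarrow{F}\mathcal C\xrightarrow{G}\mathcal B$ such that $F(\mathrm{pt})$ and $G(\mathrm{pt})$ are surjective and, for all $c,c'\in\mathcal C(\mathrm{pt})$, the induced span $$\mathcal A(Fc,Fc')\longleftarrow\mathcal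 C(c,c')\longrightarrow\mathcal B(Gc,Gc')$$ is an $(n-1)$-equivalence. Whitney $n$-categories $\mathcal A,\mathcal B$ are *$n$-equivalent* if there are a Whitney $n$-category $\mathcal C$ and functors $F:\mathcal C\to\mathcal A$, $G:\mathcal C\to\mathcal B$ that form an $n$-equivalence. **Proposition.** For every $n\in\mathbb{N}$, being $n$-equivalent is an equivalence relation (reflexive, symmetric and transitive) on Whitney $n$-categories. -/

import Mathlib

open Set Filter Topology CategoryTheory Opposite
open scoped ContDiff

universe u

namespace WhitneyStrat

/-! ### Submanifolds, tangent spaces and Whitney's condition B in a normed space -/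

section Local

variable {E E' : Type*} [NormedAddCommGroup E] [NormedSpace ℝ E]
  [NormedAddCommGroup E'] [NormedSpace ℝ E']

/-- `A` is a smooth embedded (hence locally closed) submanifold of dimension `d`: near each of its
points some smooth chart of the ambient space straightens `A` to a `d`-dimensional linear
subspace. -/
def IsSubmanifold (d : ℕ) (A : Set E) : Prop :=
  ∀ x ∈ A, ∃ e : OpenPartialHomeomorph E E, x ∈ e.source ∧
    ContDiffOn ℝ ∞ e e.source ∧ ContDiffOn ℝ ∞ e.symm e.target ∧
    ∃ W : Submodule ℝ E, Module.finrank ℝ W = d ∧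
      e.source ∩ A = e.source ∩ e ⁻¹' (W : Set E)

/-- The tangent space to `A` at `x`. For a submanifold the tangent cone is already a linear
subspace, the usual tangent space. -/
def tangentSpace (A : Set E) (x : E) : Submodule ℝ E :=
  Submodule.span ℝ (tangentConeAt ℝ A x)

/-- Convergence `P n → Q` in the Grassmannian of a finite-dimensional space: all subspaces have
the same dimension, and `Q` consists of the limits of convergent sequences `w n ∈ P n`. -/
def SubspaceTendsto (P : ℕ → Submodule ℝ E) (Q : Submodule ℝ E) : Prop :=
  (∀ n, Module.finrank ℝ (P n) = Module.finrank ℝ Q) ∧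
    ∀ v, v ∈ Q ↔ ∃ w : ℕ → E, (∀ n, w n ∈ P n) ∧ Tendsto w atTop (𝓝 v)

/-- Whitney's condition B for the pair `(A, B)`: if `a n ∈ A` and `b n ∈ B` converge to a point of
`A`, the secant lines through `a n` and `b n` converge to `L` and the tangent spaces of `B` at
`b n` converge to `P`, then `L ≤ P`. -/
def WhitneyB (A B : Set E) : Prop :=
  ∀ x ∈ A, ∀ a b : ℕ → E, (∀ n, a n ∈ A) → (∀ n, b n ∈ B) → (∀ n, a n ≠ b n) →
    Tendsto a atTop (𝓝 x) → Tendsto b atTop (𝓝 x) →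
    ∀ L P : Submodule ℝ E,
      SubspaceTendsto (fun n => Submodule.span ℝ {b n - a n}) L →
      SubspaceTendsto (fun n => tangentSpace B (b n)) P → L ≤ P

end Local

/-! ### Stratified spaces and maps -/

/-- A compact Whitney stratified subspace of `ℝᵏ`, given by its set of strata. (Local finiteness
amounts to finiteness by compactness, and the order of the poset of strata is
`A ≤ B ↔ A ⊆ closure B`.) -/
structure StratSpace (k : ℕ) where
  strata : Set (Set (Fin k → ℝ))
  finite : strata.Finite
  isConnected : ∀ A ∈ strata, _root_.IsConnected A
  isSubmanifold : ∀ A ∈ strata, ∃ d, IsSubmanifold d A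
  disjoint : ∀ A ∈ strata, ∀ B ∈ strata, A ≠ B → Disjoint A B
  frontier : ∀ A ∈ strata, ∀ B ∈ strata, (A ∩ closure B).Nonempty → A ⊆ closure B
  isCompact : IsCompact (⋃₀ strata)
  whitneyB : ∀ A ∈ strata, ∀ B ∈ strata, WhitneyB A B

/-- The underlying set. -/
def StratSpace.carrier {k : ℕ} (X : StratSpace k) : Set (Fin k → ℝ) := ⋃₀ X.strata

/-- `F` (a smooth map of ambient spaces with `F(X) ⊆ Y`) is a stratified submersion `X → Y`: the
preimage of each stratum `B` of `Y` is a union of strata of `X`, and each of these is mapped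
submersively to `B`. -/
def IsStratified {k l : ℕ} (X : StratSpace k) (Y : StratSpace l)
    (F : (Fin k → ℝ) → (Fin l → ℝ)) : Prop :=
  ∀ B ∈ Y.strata, ∀ A ∈ X.strata, (A ∩ F ⁻¹' B).Nonempty →
    A ⊆ F ⁻¹' B ∧
    ∀ x ∈ A, (tangentSpace A x).map (fderiv ℝ F x).toLinearMap = tangentSpace B (F x)

/-- `X'` is a subdivision of `X`. -/
def IsSubdivision {k : ℕ} (X' X : StratSpace k) : Prop :=
  X'.carrier = X.carrier ∧ ∀ A' ∈ X'.strata, ∃ A ∈ X.strata, A' ⊆ A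

/-- `F` is prestratified: it is stratified after subdividing the source. -/
def IsPrestratified {k l : ℕ} (X : StratSpace k) (Y : StratSpace l)
    (F : (Fin k → ℝ) → (Fin l → ℝ)) : Prop :=
  ∃ X' : StratSpace k, IsSubdivision X' X ∧ IsStratified X' Y F

/-- `F, G : X → Y` are homotopic, relative to the strata of `X` of dimension `< n`, by a smooth
homotopy through maps with property `P`. -/
def HomotopicThrough {k l : ℕ} (P : ((Fin k → ℝ) → (Fin l → ℝ)) → Prop) (n : ℕ)
    (X : StratSpace k) (Y : StratSpace l) (F G : (Fin k → ℝ) → (Fin l → ℝ)) : Prop :=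
  ∃ h : (Fin k → ℝ) × ℝ → (Fin l → ℝ), ContDiff ℝ ∞ h ∧
    (∀ t ∈ Icc (0 : ℝ) 1, MapsTo (fun x => h (x, t)) X.carrier Y.carrier ∧
      P (fun x => h (x, t))) ∧
    (∀ x ∈ X.carrier, h (x, 0) = F x) ∧ (∀ x ∈ X.carrier, h (x, 1) = G x) ∧
    ∀ S ∈ X.strata, (∃ d < n, IsSubmanifold d S) →
      ∀ x ∈ S, ∀ t ∈ Icc (0 : ℝ) 1, h (x, t) = h (x, 0)

/-- `F : Y → X` trivially covers the stratum `A` of `X`: the preimage of `A` in `Y` is a single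
stratum, which `F` maps diffeomorphically to `A`. -/
def TriviallyCovers {k l : ℕ} (Y : StratSpace k) (F : (Fin k → ℝ) → (Fin l → ℝ))
    (A : Set (Fin l → ℝ)) : Prop :=
  ∃ A' ∈ Y.strata, Y.carrier ∩ F ⁻¹' A = A' ∧
    ∃ (U : Set (Fin l → ℝ)) (G : (Fin l → ℝ) → (Fin k → ℝ)), IsOpen U ∧ A ⊆ U ∧
      ContDiffOn ℝ ∞ G U ∧ MapsTo F A' A ∧ MapsTo G A A' ∧ InvOn G F A' A

/-- Compact cellular stratified spaces of dimension `≤ n`. -/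
structure CellSpace (n : ℕ) where
  k : ℕ
  space : StratSpace k
  contractible : ∀ A ∈ space.strata, ContractibleSpace A
  dim_le : ∀ A ∈ space.strata, ∃ d ≤ n, IsSubmanifold d A

/-- Smooth maps `X → Y`, given by a smooth map of the ambient Euclidean spaces. (Representatives
with the same restriction to `X`, in particular with the same germ along `X`, are identified by the
homotopy relations below.) -/
@[ext]
structure SmoothMap {n : ℕ} (X Y : CellSpace n) where
  toFun : (Fin X.k → ℝ) → (Fin Y.k → ℝ)
  contDiff : ContDiff ℝ ∞ toFun
  mapsTo : MapsTo toFun X.space.carrier Y.space.carrier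

instance (n : ℕ) : Category (CellSpace n) where
  Hom X Y := SmoothMap X Y
  id X := ⟨id, contDiff_id, mapsTo_id _⟩
  comp f g := ⟨g.toFun ∘ f.toFun, g.contDiff.comp f.contDiff, g.mapsTo.comp f.mapsTo⟩

/-- The class of stratified maps. -/
def stratified (n : ℕ) : MorphismProperty (CellSpace n) :=
  fun X Y f => IsStratified X.space Y.space (SmoothMap.toFun f)

/-- The class of prestratified maps. -/
def prestratified (n : ℕ) : MorphismProperty (CellSpace n) :=
  fun X Y f => IsPrestratified X.space Y.space (SmoothMap.toFun f)

theorem stratSpace_exists_stratum {k : ℕ} {X : StratSpace k} {x : Fin k → ℝ}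
    (hx : x ∈ X.carrier) : ∃ A ∈ X.strata, x ∈ A := by
  simpa [StratSpace.carrier] using hx

theorem isStratified_id {k : ℕ} (X : StratSpace k) : IsStratified X X id := by
  intro B hB A hA ⟨x, hxA, hxB⟩
  have : A = B := by
    by_contra h
    exact (Set.disjoint_left.1 (X.disjoint A hA B hB h)) hxA hxB
  subst this
  refine ⟨fun _ h => h, fun x _ => ?_⟩
  rw [fderiv_id]
  exact Submodule.map_id _

theorem IsStratified.comp {k l m : ℕ} {X : StratSpace k} {Y : StratSpace l} {Z : StratSpace m}
    {F : (Fin k → ℝ) → (Fin l → ℝ)} {G : (Fin l → ℝ) → (Fin m → ℝ)}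
    (hFs : ContDiff ℝ ∞ F) (hGs : ContDiff ℝ ∞ G) (hFm : MapsTo F X.carrier Y.carrier)
    (hF : IsStratified X Y F) (hG : IsStratified Y Z G) : IsStratified X Z (G ∘ F) := by
  intro C hC A hA ⟨x, hxA, hxC⟩
  obtain ⟨B, hB, hxB⟩ := stratSpace_exists_stratum (hFm (mem_sUnion_of_mem hxA hA))
  obtain ⟨h1, h2⟩ := hF B hB A hA ⟨x, hxA, hxB⟩
  obtain ⟨h3, h4⟩ := hG C hC B hB ⟨F x, hxB, hxC⟩
  refine ⟨fun y hy => h3 (h1 hy), fun y hy => ?_⟩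
  rw [fderiv_comp y (hGs.differentiable (by simp) _) (hFs.differentiable (by simp) _)]
  rw [show ((fderiv ℝ G (F y)).comp (fderiv ℝ F y)).toLinearMap
    = (fderiv ℝ G (F y)).toLinearMap ∘ₗ (fderiv ℝ F y).toLinearMap from rfl, Submodule.map_comp,
    h2 y hy, h4 _ (h1 hy)]
  rfl

instance (n : ℕ) : (stratified n).IsMultiplicative where
  id_mem X := isStratified_id X.space
  comp_mem f g hf hg :=
    IsStratified.comp (F := SmoothMap.toFun f) (G := SmoothMap.toFun g)
      (SmoothMap.contDiff f) (SmoothMap.contDiff g) (SmoothMap.mapsTo f) hf hg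

/-- Compact cellular stratified spaces of dimension `≤ n` and stratified maps. -/
abbrev StratMaps (n : ℕ) := WideSubcategory (stratified n)

/-- Compact cellular stratified spaces of dimension `≤ n` and (composites of) prestratified maps.
Taking the closure under composition adds nothing, as a composite of prestratified maps is
prestratified. -/
abbrev PrestratMaps (n : ℕ) := WideSubcategory (prestratified n).multiplicativeClosure

/-- Homotopy through stratified maps relative to strata of dimension `< n`. -/
def stratHomotopy (n : ℕ) : HomRel (StratMaps n) := fun X Y f g =>
  HomotopicThrough (IsStratified X.obj.space Y.obj.space) n X.obj.space Y.obj.space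
    (SmoothMap.toFun f.hom) (SmoothMap.toFun g.hom)

/-- Homotopy through prestratified maps relative to strata of dimension `< n`. -/
def prestratHomotopy (n : ℕ) : HomRel (PrestratMaps n) := fun X Y f g =>
  HomotopicThrough (IsPrestratified X.obj.space Y.obj.space) n X.obj.space Y.obj.space
    (SmoothMap.toFun f.hom) (SmoothMap.toFun g.hom)

/-- The category of compact cellular stratified spaces of dimension `≤ n` and homotopy classes of
stratified maps relative to strata of dimension `< n`. -/
abbrev Strat (n : ℕ) := CategoryTheory.Quotient (stratHomotopy n)

/-- The category of compact cellular stratified spaces of dimension `≤ n` and homotopy classes of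
prestratified maps relative to strata of dimension `< n`. -/
abbrev Prestrat (n : ℕ) := CategoryTheory.Quotient (prestratHomotopy n)

theorem IsStratified.isPrestratified {k l : ℕ} {X : StratSpace k} {Y : StratSpace l}
    {F : (Fin k → ℝ) → (Fin l → ℝ)} (h : IsStratified X Y F) : IsPrestratified X Y F :=
  ⟨X, ⟨rfl, fun A hA => ⟨A, hA, subset_rfl⟩⟩, h⟩

/-- A stratified map is prestratified. -/
def stratMapsToPrestratMaps (n : ℕ) : StratMaps n ⥤ PrestratMaps n where
  obj X := ⟨X.obj⟩
  map f := ⟨f.hom, .of _ (IsStratified.isPrestratified f.property)⟩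

/-- The functor from stratified to prestratified maps, on homotopy classes. -/
def stratToPrestrat (n : ℕ) : Strat n ⥤ Prestrat n :=
  CategoryTheory.Quotient.lift _ (stratMapsToPrestratMaps n ⋙ CategoryTheory.Quotient.functor _) (by
    rintro X Y f g ⟨h, h1, h2, h3⟩
    exact CategoryTheory.Quotient.sound _
      ⟨h, h1, fun t ht => ⟨(h2 t ht).1, (h2 t ht).2.isPrestratified⟩, h3⟩)

/-- A sieve on `X` is covering if each stratum of `X` is trivially covered by a map in it. -/
def IsCovering {n : ℕ} {X : Strat n} (S : Sieve X) : Prop :=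
  ∀ A ∈ X.as.obj.space.strata, ∃ (Y : StratMaps n) (f : Y ⟶ X.as),
    S ((CategoryTheory.Quotient.functor (stratHomotopy n)).map f) ∧
    TriviallyCovers Y.obj.space (SmoothMap.toFun f.hom) A

/-- A presheaf on `Prestrat n` is a Whitney `n`-category if its restriction to `Strat n` is a sheaf,
i.e. matching families for covering sieves have unique amalgamations. -/
def IsWhitney (n : ℕ) : ObjectProperty ((Prestrat n)ᵒᵖ ⥤ Type u) := fun A =>
  ∀ (X : Strat n) (S : Sieve X), IsCovering S →
    Presieve.IsSheafFor ((stratToPrestrat n).op ⋙ A) S.arrows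

/-- Whitney `n`-categories; functors between them are the natural transformations. -/
abbrev WhitneyCategory (n : ℕ) := (IsWhitney.{u} n).FullSubcategory

/-! ### Products with the interval -/

section Product

variable {E E' : Type*} [NormedAddCommGroup E] [NormedSpace ℝ E]
  [NormedAddCommGroup E'] [NormedSpace ℝ E']

theorem finrank_submodule_prod [FiniteDimensional ℝ E] [FiniteDimensional ℝ E']
    (V : Submodule ℝ E) (R : Submodule ℝ E') :
    Module.finrank ℝ (V.prod R) = Module.finrank ℝ V + Module.finrank ℝ R := by
  let e : (V.prod R) ≃ₗ[ℝ] V × R :=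
    { toFun := fun z => (⟨z.1.1, z.2.1⟩, ⟨z.1.2, z.2.2⟩)
      invFun := fun z => ⟨(z.1, z.2), z.1.2, z.2.2⟩
      map_add' := fun _ _ => rfl
      map_smul' := fun _ _ => rfl
      left_inv := fun _ => rfl
      right_inv := fun _ => rfl }
  rw [e.finrank_eq, Module.finrank_prod]

theorem IsSubmanifold.prod {d d' : ℕ} {A : Set E} {B : Set E'}
    [FiniteDimensional ℝ E] [FiniteDimensional ℝ E']
    (hA : IsSubmanifold d A) (hB : IsSubmanifold d' B) : IsSubmanifold (d + d') (A ×ˢ B) := by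
  rintro ⟨x, y⟩ ⟨hx, hy⟩
  obtain ⟨e, h1, h2, h3, W, hW, h4⟩ := hA x hx
  obtain ⟨e', h1', h2', h3', W', hW', h4'⟩ := hB y hy
  refine ⟨e.prod e', ⟨h1, h1'⟩, ?_, ?_, W.prod W', ?_, ?_⟩
  · exact h2.prodMap h2'
  · exact h3.prodMap h3'
  · rw [finrank_submodule_prod, hW, hW']
  · ext ⟨a, b⟩
    have ha := Set.ext_iff.1 h4 a
    have hb := Set.ext_iff.1 h4' b
    simp at ha hb ⊢
    tauto

theorem IsSubmanifold.preimage {d : ℕ} {A : Set E} (M : E' ≃L[ℝ] E) (hA : IsSubmanifold d A) :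
    IsSubmanifold d (M ⁻¹' A) := by
  intro x hx
  obtain ⟨e, h1, h2, h3, W, hW, h4⟩ := hA (M x) hx
  refine ⟨(M.toHomeomorph.toOpenPartialHomeomorph.trans e).trans
    M.symm.toHomeomorph.toOpenPartialHomeomorph, ?_, ?_, ?_, W.comap M.toLinearMap, ?_, ?_⟩
  · simpa using h1
  · refine M.symm.contDiff.comp_contDiffOn (h2.comp M.contDiff.contDiffOn ?_)
    intro y hy; simpa using hy
  · refine M.symm.contDiff.comp_contDiffOn (h3.comp M.contDiff.contDiffOn ?_)
    intro y hy; simpa using hy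
  · rw [← hW]
    rw [show W.comap M.toLinearMap = W.map (M.toLinearEquiv.symm : E →ₗ[ℝ] E') from
      Submodule.comap_equiv_eq_map_symm M.toLinearEquiv W]
    exact LinearEquiv.finrank_map_eq _ _
  · ext y
    have hy := Set.ext_iff.1 h4 (M y)
    simp at hy ⊢
    exact hy

theorem isSubmanifold_singleton (c : ℝ) : IsSubmanifold 0 ({c} : Set ℝ) := by
  intro x hx
  refine ⟨(Homeomorph.subRight c).toOpenPartialHomeomorph, by simp, ?_, ?_, ⊥, by simp, ?_⟩
  · exact (contDiff_id.sub contDiff_const).contDiffOn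
  · exact (contDiff_id.add contDiff_const).contDiffOn
  · ext y; simp [sub_eq_zero]

theorem isSubmanifold_open {A : Set ℝ} (hA : IsOpen A) : IsSubmanifold 1 A := by
  intro x hx
  refine ⟨OpenPartialHomeomorph.ofSet A hA, hx, contDiff_id.contDiffOn, contDiff_id.contDiffOn,
    ⊤, by simp, ?_⟩
  simp

theorem tangentSpace_map_le {F : E → E'} {F' : E →L[ℝ] E'} {A : Set E} {B : Set E'} {x : E}
    (hF : HasFDerivAt F F' x) (h : MapsTo F A B) :
    (tangentSpace A x).map F'.toLinearMap ≤ tangentSpace B (F x) := by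
  rw [tangentSpace, Submodule.map_span, tangentSpace, Submodule.span_le]
  rintro _ ⟨v, hv, rfl⟩
  refine Submodule.subset_span (tangentConeAt_mono h.image_subset ?_)
  exact hF.hasFDerivWithinAt.mapsTo_tangent_cone hv

theorem tangentSpace_preimage (M : E' ≃L[ℝ] E) (A : Set E) (x : E') :
    tangentSpace (M ⁻¹' A) x = (tangentSpace A (M x)).comap M.toLinearMap := by
  apply le_antisymm
  · rw [← Submodule.map_le_iff_le_comap]
    exact tangentSpace_map_le (F' := (M : E' →L[ℝ] E)) M.hasFDerivAt (fun y hy => hy)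
  · intro v hv
    have := tangentSpace_map_le (F' := (M.symm : E →L[ℝ] E')) (A := A) (B := M ⁻¹' A) (x := M x)
      M.symm.hasFDerivAt (fun y hy => by simpa using hy)
    have h := this ⟨M v, hv, rfl⟩
    simpa using h

theorem tangentSpace_prod {A : Set E} {B : Set E'} {x : E} {y : E'} (hx : x ∈ A) (hy : y ∈ B) :
    tangentSpace (A ×ˢ B) (x, y) = (tangentSpace A x).prod (tangentSpace B y) := by
  apply le_antisymm
  · intro v hv
    refine ⟨?_, ?_⟩
    · exact tangentSpace_map_le (F := Prod.fst) (A := A ×ˢ B) (B := A) (x := (x, y))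
        hasFDerivAt_fst (fun z hz => hz.1) ⟨v, hv, rfl⟩
    · exact tangentSpace_map_le (F := Prod.snd) (A := A ×ˢ B) (B := B) (x := (x, y))
        hasFDerivAt_snd (fun z hz => hz.2) ⟨v, hv, rfl⟩
  · rintro ⟨v, w⟩ ⟨hv, hw⟩
    have h1 := tangentSpace_map_le (F := fun z => (z, y)) (A := A) (B := A ×ˢ B) (x := x)
        (hasFDerivAt_prodMk_left x y) (fun z hz => ⟨hz, hy⟩) ⟨v, hv, rfl⟩
    have h2 := tangentSpace_map_le (F := fun z => (x, z)) (A := B) (B := A ×ˢ B) (x := y)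
        (hasFDerivAt_prodMk_right x y) (fun z hz => ⟨hx, hz⟩) ⟨w, hw, rfl⟩
    have := add_mem h1 h2
    simpa using this

theorem tangentSpace_singleton (x : E) : tangentSpace ({x} : Set E) x = ⊥ := by
  rw [tangentSpace, Submodule.span_eq_bot]
  intro v hv
  have : ¬ AccPt x (𝓟 ({x} : Set E)) := by
    intro h
    rw [accPt_iff_frequently] at h
    simpa using h.exists
  exact tangentConeAt_subset_zero this hv

theorem tangentSpace_open {A : Set E} (hA : IsOpen A) {x : E} (hx : x ∈ A) :
    tangentSpace A x = ⊤ := by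
  rw [tangentSpace, tangentConeAt_of_mem_nhds (hA.mem_nhds hx), Submodule.span_univ]

theorem SubspaceTendsto.map (M : E ≃L[ℝ] E') {P : ℕ → Submodule ℝ E} {Q : Submodule ℝ E}
    (h : SubspaceTendsto P Q) :
    SubspaceTendsto (fun n => (P n).map M.toLinearMap) (Q.map M.toLinearMap) := by
  refine ⟨fun n => ?_, fun v => ?_⟩
  · exact ((LinearEquiv.finrank_map_eq M.toLinearEquiv (P n)).trans (h.1 n)).trans
      (LinearEquiv.finrank_map_eq M.toLinearEquiv Q).symm
  · constructor
    · rintro ⟨v, hv, rfl⟩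
      obtain ⟨w, hw, hw'⟩ := (h.2 v).1 hv
      exact ⟨fun n => M (w n), fun n => ⟨w n, hw n, rfl⟩, (M.continuous.tendsto v).comp hw'⟩
    · rintro ⟨w, hw, hw'⟩
      refine ⟨M.symm v, (h.2 _).2 ⟨fun n => M.symm (w n), fun n => ?_,
        (M.symm.continuous.tendsto v).comp hw'⟩, by simp⟩
      obtain ⟨u, hu, hu'⟩ := hw n
      dsimp only
      rw [← hu']
      simpa using hu

theorem WhitneyB.preimage (M : E' ≃L[ℝ] E) {A B : Set E} (h : WhitneyB A B) :
    WhitneyB (M ⁻¹' A) (M ⁻¹' B) := by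
  intro x hx a b ha hb hab hax hbx L P hL hP
  have hL' := hL.map M
  have hP' := hP.map M
  have := h (M x) hx (fun n => M (a n)) (fun n => M (b n)) ha hb (fun n => by simpa using hab n)
    ((M.continuous.tendsto x).comp hax) ((M.continuous.tendsto x).comp hbx)
    (L.map M.toLinearMap) (P.map M.toLinearMap)
    (by simpa [Submodule.map_span, map_sub] using hL')
    (by
      convert hP' using 2 with n
      rw [tangentSpace_preimage]
      exact (Submodule.map_comap_eq_of_surjective M.surjective _).symm)
  intro v hv
  obtain ⟨w, hw, hw'⟩ := this ⟨v, hv, rfl⟩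
  have : w = v := M.injective hw'
  exact this ▸ hw

theorem subspaceTendsto_span {u : ℕ → E} {c : ℕ → ℝ} {a : E} (ha : a ≠ 0)
    (h : Tendsto (fun n => c n • u n) atTop (𝓝 a)) (h0 : ∀ n, c n • u n ≠ 0) :
    SubspaceTendsto (fun n => Submodule.span ℝ {u n}) (Submodule.span ℝ {a}) := by
  refine ⟨fun n => ?_, fun v => ⟨fun hv => ?_, ?_⟩⟩
  · rw [finrank_span_singleton ha, finrank_span_singleton]
    intro hu
    exact h0 n (by simp [hu])
  · obtain ⟨r, rfl⟩ := Submodule.mem_span_singleton.1 hv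
    refine ⟨fun n => r • c n • u n, fun n => ?_, h.const_smul r⟩
    exact Submodule.smul_mem _ _ (Submodule.smul_mem _ _ (Submodule.mem_span_singleton_self _))
  · rintro ⟨w, hw, hwv⟩
    obtain ⟨φ, hφ⟩ : ∃ φ : StrongDual ℝ E, φ a ≠ 0 := by
      obtain ⟨φ, -, hφ⟩ := exists_dual_vector ℝ a (norm_ne_zero_iff.2 ha)
      exact ⟨φ, by rw [hφ]; simpa using ha⟩
    have key : ∀ n, φ (c n • u n) • w n = φ (w n) • c n • u n := by
      intro n
      obtain ⟨r, hr⟩ := Submodule.mem_span_singleton.1 (hw n)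
      rw [← hr]
      simp only [map_smul, smul_eq_mul, smul_smul]
      congr 1
      ring
    have h1 : Tendsto (fun n => φ (c n • u n) • w n) atTop (𝓝 (φ a • v)) :=
      ((φ.continuous.tendsto a).comp h).smul hwv
    have h2 : Tendsto (fun n => φ (w n) • c n • u n) atTop (𝓝 (φ v • a)) :=
      ((φ.continuous.tendsto v).comp hwv).smul h
    have h3 : φ a • v = φ v • a := by
      refine tendsto_nhds_unique h1 ?_
      simpa only [key] using h2
    refine Submodule.mem_span_singleton.2 ⟨(φ a)⁻¹ * φ v, ?_⟩
    rw [mul_smul, ← h3, smul_smul, inv_mul_cancel₀ hφ, one_smul]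

theorem SubspaceTendsto.comp_add {P : ℕ → Submodule ℝ E} {Q : Submodule ℝ E}
    (h : SubspaceTendsto P Q) (N : ℕ) : SubspaceTendsto (fun n => P (n + N)) Q := by
  refine ⟨fun n => h.1 _, fun v => ⟨fun hv => ?_, ?_⟩⟩
  · obtain ⟨w, hw, hw'⟩ := (h.2 v).1 hv
    exact ⟨fun n => w (n + N), fun n => hw _, (tendsto_add_atTop_iff_nat N).2 hw'⟩
  · rintro ⟨w, hw, hw'⟩
    refine (h.2 v).2 ⟨fun n => if N ≤ n then w (n - N) else 0, fun n => ?_, ?_⟩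
    · dsimp only
      split_ifs with hn
      · have := hw (n - N)
        dsimp only at this
        rwa [Nat.sub_add_cancel hn] at this
      · exact zero_mem _
    · rw [← tendsto_add_atTop_iff_nat N]
      simpa using hw'

theorem WhitneyB.prod {A B : Set E} {S T : Set E'} [FiniteDimensional ℝ E]
    [FiniteDimensional ℝ E'] (h : WhitneyB A B) (R : Submodule ℝ E')
    (hR : ∀ t ∈ T, tangentSpace T t = R)
    (hST : ∀ s ∈ S, s ∈ closure T → ∀ s' ∈ S, ∀ t ∈ T, t - s' ∈ R) :
    WhitneyB (A ×ˢ S) (B ×ˢ T) := by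
  rintro ⟨x, s⟩ ⟨hx, hs⟩ a b ha hb hab hax hbx L P hL hP
  have hax1 := (continuous_fst.tendsto _).comp hax
  have hbx1 := (continuous_fst.tendsto _).comp hbx
  have hbx2 := (continuous_snd.tendsto _).comp hbx
  have hsT : s ∈ closure T := mem_closure_of_tendsto hbx2 (Eventually.of_forall fun n => (hb n).2)
  have htan : ∀ n, tangentSpace (B ×ˢ T) (b n) = (tangentSpace B (b n).1).prod R := by
    intro n
    rw [← hR _ (hb n).2]
    exact tangentSpace_prod (hb n).1 (hb n).2
  simp only [htan] at hP
  set P1 : Submodule ℝ E := P.comap (LinearMap.inl ℝ E E') with hP1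
  have hPR : P = P1.prod R := by
    have hRP : ∀ r ∈ R, ((0 : E), r) ∈ P := fun r hr =>
      (hP.2 _).2 ⟨fun _ => (0, r), fun n => ⟨zero_mem _, hr⟩, tendsto_const_nhds⟩
    ext ⟨v, r⟩
    constructor
    · intro hv
      obtain ⟨w, hw, hw'⟩ := (hP.2 _).1 hv
      have hr : r ∈ R := R.closed_of_finiteDimensional.mem_of_tendsto
        ((continuous_snd.tendsto _).comp hw') (Eventually.of_forall fun n => (hw n).2)
      refine ⟨?_, hr⟩
      have := sub_mem hv (hRP r hr)
      simpa [hP1] using this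
    · rintro ⟨hv, hr⟩
      have := add_mem (show (v, (0 : E')) ∈ P from hv) (hRP r hr)
      simpa using this
  have hfin : ∀ (V : Submodule ℝ E), Module.finrank ℝ (V.prod R) =
      Module.finrank ℝ V + Module.finrank ℝ R := fun V => finrank_submodule_prod V R
  have hP1t : SubspaceTendsto (fun n => tangentSpace B (b n).1) P1 := by
    refine ⟨fun n => ?_, fun v => ⟨fun hv => ?_, ?_⟩⟩
    · have := hP.1 n
      rw [hPR, hfin, hfin] at this
      exact Nat.add_right_cancel this
    · obtain ⟨w, hw, hw'⟩ := (hP.2 _).1 (show (v, (0 : E')) ∈ P from hv)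
      exact ⟨fun n => (w n).1, fun n => (hw n).1, (continuous_fst.tendsto _).comp hw'⟩
    · rintro ⟨w, hw, hw'⟩
      exact (hP.2 _).2 ⟨fun n => (w n, 0), fun n => ⟨hw n, zero_mem _⟩,
        hw'.prodMk_nhds tendsto_const_nhds⟩
  rintro ⟨v, r⟩ hv
  rw [hPR]
  obtain ⟨w, hw, hw'⟩ := (hL.2 _).1 hv
  choose c hc using fun n => Submodule.mem_span_singleton.1 (hw n)
  have hw1 : Tendsto (fun n => c n • ((b n).1 - (a n).1)) atTop (𝓝 v) := by
    have := (continuous_fst.tendsto _).comp hw'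
    refine this.congr fun n => ?_
    simp [← hc n]
  have hw2 : Tendsto (fun n => c n • ((b n).2 - (a n).2)) atTop (𝓝 r) := by
    have := (continuous_snd.tendsto _).comp hw'
    refine this.congr fun n => ?_
    simp [← hc n]
  refine ⟨?_, R.closed_of_finiteDimensional.mem_of_tendsto hw2 (Eventually.of_forall fun n =>
    R.smul_mem _ (hST s hs hsT _ (ha n).2 _ (hb n).2))⟩
  by_cases hv0 : v = 0
  · rw [hv0]; exact zero_mem _
  obtain ⟨N, hN⟩ := eventually_atTop.1 (hw1.eventually_ne hv0)
  have hsp := subspaceTendsto_span (u := fun n => (b (n + N)).1 - (a (n + N)).1)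
    (c := fun n => c (n + N)) hv0
    ((tendsto_add_atTop_iff_nat (f := fun n => c n • ((b n).1 - (a n).1)) N).2 hw1)
    (fun n => hN _ (Nat.le_add_left _ _))
  refine h x hx (fun n => (a (n + N)).1) (fun n => (b (n + N)).1) (fun n => (ha _).1)
    (fun n => (hb _).1) (fun n hn => ?_) ((tendsto_add_atTop_iff_nat N).2 hax1)
    ((tendsto_add_atTop_iff_nat N).2 hbx1) _ _ hsp (hP1t.comp_add N)
    (Submodule.mem_span_singleton_self v)
  refine hN (n + N) (Nat.le_add_left _ _) ?_
  rw [hn, sub_self, smul_zero]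

end Product

/-- The identification `ℝᵏ × ℝ ≃ ℝᵏ⁺¹`. -/
noncomputable def snocEquiv (k : ℕ) : ((Fin k → ℝ) × ℝ) ≃L[ℝ] (Fin (k + 1) → ℝ) :=
  LinearEquiv.toContinuousLinearEquiv
    { toFun := fun p => Fin.snoc p.1 p.2
      invFun := fun z => (Fin.init z, z (Fin.last k))
      map_add' := fun p q => by
        ext i; refine Fin.lastCases ?_ (fun j => ?_) i <;> simp
      map_smul' := fun c p => by
        ext i; refine Fin.lastCases ?_ (fun j => ?_) i <;> simp
      left_inv := fun p => by simp
      right_inv := fun z => by simp }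

/-- The strata of the unit interval: the end points and the interior. -/
def intervalStrata : Set (Set ℝ) := {{0}, {1}, Ioo 0 1}

theorem sUnion_intervalStrata : ⋃₀ intervalStrata = Icc (0 : ℝ) 1 := by
  ext t
  simp only [intervalStrata, sUnion_insert, sUnion_singleton, mem_union, mem_singleton_iff,
    mem_Ioo, mem_Icc]
  constructor
  · rintro (rfl | rfl | h)
    · norm_num
    · norm_num
    · exact ⟨h.1.le, h.2.le⟩
  · rintro ⟨h0, h1⟩
    rcases h0.eq_or_lt with h | h
    · exact Or.inl h.symm
    · rcases h1.eq_or_lt with h' | h'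
      · exact Or.inr (Or.inl h')
      · exact Or.inr (Or.inr ⟨h, h'⟩)

/-- The stratum `A × T` of `X × [0,1]`. -/
def prodStratum {k : ℕ} (A : Set (Fin k → ℝ)) (T : Set ℝ) : Set (Fin (k + 1) → ℝ) :=
  (snocEquiv k).symm ⁻¹' (A ×ˢ T)

theorem prodStratum_eq_image {k : ℕ} (A : Set (Fin k → ℝ)) (T : Set ℝ) :
    prodStratum A T = snocEquiv k '' (A ×ˢ T) := by
  rw [prodStratum, ← ContinuousLinearEquiv.image_eq_preimage_symm]

theorem contractible_intervalStrata {T : Set ℝ} (hT : T ∈ intervalStrata) :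
    ContractibleSpace T := by
  rcases hT with rfl | rfl | rfl
  · exact (convex_singleton (0 : ℝ)).contractibleSpace (singleton_nonempty _)
  · exact (convex_singleton (1 : ℝ)).contractibleSpace (singleton_nonempty _)
  · exact (convex_Ioo (0 : ℝ) 1).contractibleSpace ⟨1 / 2, by norm_num⟩

theorem isConnected_intervalStrata {T : Set ℝ} (hT : T ∈ intervalStrata) :
    _root_.IsConnected T := by
  rcases hT with rfl | rfl | rfl
  · exact isConnected_singleton
  · exact isConnected_singleton
  · exact isConnected_Ioo one_pos

theorem isSubmanifold_intervalStrata {T : Set ℝ} (hT : T ∈ intervalStrata) :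
    ∃ d ≤ 1, IsSubmanifold d T := by
  rcases hT with rfl | rfl | rfl
  · exact ⟨0, zero_le_one, isSubmanifold_singleton 0⟩
  · exact ⟨0, zero_le_one, isSubmanifold_singleton 1⟩
  · exact ⟨1, le_rfl, isSubmanifold_open isOpen_Ioo⟩

theorem disjoint_intervalStrata {S T : Set ℝ} (hS : S ∈ intervalStrata)
    (hT : T ∈ intervalStrata) (h : S ≠ T) : Disjoint S T := by
  rcases hS with rfl | rfl | rfl <;> rcases hT with rfl | rfl | rfl <;> simp at h ⊢

theorem frontier_intervalStrata {S T : Set ℝ} (hS : S ∈ intervalStrata)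
    (hT : T ∈ intervalStrata) (h : (S ∩ closure T).Nonempty) : S ⊆ closure T := by
  obtain ⟨x, h1, h2⟩ := h
  rcases hT with rfl | rfl | rfl
  · rw [closure_singleton] at h2 ⊢
    rcases hS with rfl | rfl | rfl
    · exact subset_rfl
    · simp_all
    · simp_all
  · rw [closure_singleton] at h2 ⊢
    rcases hS with rfl | rfl | rfl
    · simp_all
    · exact subset_rfl
    · simp_all
  · rw [closure_Ioo (by norm_num)]
    rw [← sUnion_intervalStrata]
    exact subset_sUnion_of_mem hS

theorem whitneyB_intervalStrata {k : ℕ} {A B : Set (Fin k → ℝ)} {S T : Set ℝ}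
    (hS : S ∈ intervalStrata) (hT : T ∈ intervalStrata) (h : WhitneyB A B) :
    WhitneyB (A ×ˢ S) (B ×ˢ T) := by
  have single : ∀ c : ℝ, T = {c} → WhitneyB (A ×ˢ S) (B ×ˢ T) := by
    rintro c rfl
    refine h.prod ⊥ (fun t ht => ?_) (fun s hs hsc s' hs' t ht => ?_)
    · rw [mem_singleton_iff.1 ht]; exact tangentSpace_singleton c
    · have hSc := frontier_intervalStrata hS hT ⟨s, hs, hsc⟩ hs'
      rw [closure_singleton, mem_singleton_iff] at hSc
      rw [mem_singleton_iff] at ht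
      simp [hSc, ht]
  rcases hT with hT | hT | hT
  · exact single 0 hT
  · exact single 1 hT
  · rw [mem_singleton_iff] at hT
    subst hT
    exact h.prod ⊤ (fun t ht => tangentSpace_open isOpen_Ioo ht) (fun _ _ _ _ _ _ _ => trivial)

theorem sUnion_prodStratum {k : ℕ} (𝒜 : Set (Set (Fin k → ℝ))) :
    ⋃₀ image2 prodStratum 𝒜 intervalStrata = prodStratum (⋃₀ 𝒜) (Icc 0 1) := by
  rw [← sUnion_intervalStrata]
  ext z
  simp only [mem_sUnion, mem_image2, prodStratum, mem_preimage, mem_prod]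
  constructor
  · rintro ⟨_, ⟨A, hA, T, hT, rfl⟩, h1, h2⟩
    exact ⟨⟨A, hA, h1⟩, ⟨T, hT, h2⟩⟩
  · rintro ⟨⟨A, hA, h1⟩, ⟨T, hT, h2⟩⟩
    exact ⟨_, ⟨A, hA, T, hT, rfl⟩, h1, h2⟩

/-- The product `X × [0,1]`, stratified by the products of strata. -/
def StratSpace.prodI {k : ℕ} (X : StratSpace k) : StratSpace (k + 1) where
  strata := image2 prodStratum X.strata intervalStrata
  finite := X.finite.image2 _ (by simp [intervalStrata])
  isConnected := by
    rintro _ ⟨A, hA, T, hT, rfl⟩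
    rw [prodStratum_eq_image]
    exact ((X.isConnected A hA).prod (isConnected_intervalStrata hT)).image _
      (snocEquiv k).continuous.continuousOn
  isSubmanifold := by
    rintro _ ⟨A, hA, T, hT, rfl⟩
    obtain ⟨d, hd⟩ := X.isSubmanifold A hA
    obtain ⟨e, -, he⟩ := isSubmanifold_intervalStrata hT
    exact ⟨d + e, (hd.prod he).preimage (snocEquiv k).symm⟩
  disjoint := by
    rintro _ ⟨A, hA, T, hT, rfl⟩ _ ⟨A', hA', T', hT', rfl⟩ h
    refine Disjoint.preimage _ (Set.disjoint_prod.2 ?_)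
    by_cases hAA : A = A'
    · by_cases hTT : T = T'
      · subst hAA hTT
        exact (h rfl).elim
      · exact Or.inr (disjoint_intervalStrata hT hT' hTT)
    · exact Or.inl (X.disjoint A hA A' hA' hAA)
  frontier := by
    rintro _ ⟨A, hA, T, hT, rfl⟩ _ ⟨A', hA', T', hT', rfl⟩ h
    have hc : closure (prodStratum A' T') = prodStratum (closure A') (closure T') := by
      rw [prodStratum, prodStratum, ← closure_prod_eq]
      exact ((snocEquiv k).symm.toHomeomorph.preimage_closure _).symm
    rw [hc] at h ⊢
    obtain ⟨z, h1, h2⟩ := h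
    exact preimage_mono (prod_mono (X.frontier A hA A' hA' ⟨_, h1.1, h2.1⟩)
      (frontier_intervalStrata hT hT' ⟨_, h1.2, h2.2⟩))
  isCompact := by
    rw [sUnion_prodStratum, prodStratum_eq_image]
    exact (X.isCompact.prod isCompact_Icc).image (snocEquiv k).continuous
  whitneyB := by
    rintro _ ⟨A, hA, T, hT, rfl⟩ _ ⟨A', hA', T', hT', rfl⟩
    exact (whitneyB_intervalStrata hT hT' (X.whitneyB A hA A' hA')).preimage (snocEquiv k).symm

theorem StratSpace.carrier_prodI {k : ℕ} (X : StratSpace k) :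
    X.prodI.carrier = prodStratum X.carrier (Icc 0 1) :=
  sUnion_prodStratum X.strata

/-- The product of a compact cellular stratified space with the interval. -/
def CellSpace.prodI {n : ℕ} (X : CellSpace n) : CellSpace (n + 1) where
  k := X.k + 1
  space := X.space.prodI
  contractible := by
    rintro _ ⟨A, hA, T, hT, rfl⟩
    have := X.contractible A hA
    have := contractible_intervalStrata hT
    have e : (A ×ˢ T : Set _) ≃ₜ prodStratum A T :=
      ((snocEquiv X.k).toHomeomorph.image (A ×ˢ T)).trans
        (Homeomorph.setCongr (prodStratum_eq_image A T).symm)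
    exact (e.symm.trans (Homeomorph.Set.prod A T)).contractibleSpace
  dim_le := by
    rintro _ ⟨A, hA, T, hT, rfl⟩
    obtain ⟨d, hdn, hd⟩ := X.dim_le A hA
    obtain ⟨e, hen, he⟩ := isSubmanifold_intervalStrata hT
    exact ⟨d + e, by omega, (hd.prod he).preimage (snocEquiv X.k).symm⟩

/-- A space of dimension `≤ n`, as a space of dimension `≤ n + 1`. -/
def CellSpace.incl {n : ℕ} (X : CellSpace n) : CellSpace (n + 1) where
  k := X.k
  space := X.space
  contractible := X.contractible
  dim_le := fun A hA =>
    let ⟨d, hd, h⟩ := X.dim_le A hA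
    ⟨d, hd.trans n.le_succ, h⟩

/-- The one-point stratified space `ℝ⁰`. -/
def StratSpace.pt : StratSpace 0 where
  strata := {univ}
  finite := finite_singleton _
  isConnected := by rintro _ rfl; exact isConnected_univ
  isSubmanifold := by
    rintro _ rfl
    exact ⟨0, fun x _ => ⟨OpenPartialHomeomorph.refl _, trivial, contDiff_id.contDiffOn,
      contDiff_id.contDiffOn, ⊤, by simp, by simp⟩⟩
  disjoint := by rintro _ rfl _ rfl h; exact (h rfl).elim
  frontier := by rintro _ rfl _ rfl _; exact subset_closure
  isCompact := by simp
  whitneyB := fun A _ B _ x _ a b _ _ h => (h 0 (Subsingleton.elim _ _)).elim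

/-- The point, as an object of dimension `≤ n`. -/
def CellSpace.pt (n : ℕ) : CellSpace n where
  k := 0
  space := .pt
  contractible := by
    rintro _ rfl
    exact convex_univ.contractibleSpace (Set.nonempty_of_mem (mem_univ (0 : Fin 0 → ℝ)))
  dim_le := by
    rintro _ rfl
    exact ⟨0, n.zero_le, fun x _ => ⟨OpenPartialHomeomorph.refl _, trivial, contDiff_id.contDiffOn,
      contDiff_id.contDiffOn, ⊤, by simp, by simp⟩⟩

/-- `F × id`, on ambient spaces. -/
noncomputable def prodMap {k l : ℕ} (F : (Fin k → ℝ) → (Fin l → ℝ)) :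
    (Fin (k + 1) → ℝ) → (Fin (l + 1) → ℝ) :=
  snocEquiv l ∘ Prod.map F id ∘ (snocEquiv k).symm

/-- The product of a smooth map with the identity of the interval. -/
noncomputable def SmoothMap.prodI {n : ℕ} {X Y : CellSpace n} (f : SmoothMap X Y) :
    SmoothMap X.prodI Y.prodI where
  toFun := prodMap f.toFun
  contDiff := (snocEquiv Y.k).contDiff.comp
    ((f.contDiff.prodMap contDiff_id).comp (snocEquiv X.k).symm.contDiff)
  mapsTo := by
    intro z hz
    change z ∈ X.space.prodI.carrier at hz
    change _ ∈ Y.space.prodI.carrier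
    rw [StratSpace.carrier_prodI] at hz ⊢
    simp only [prodStratum, prodMap, mem_preimage, mem_prod, Function.comp,
      ContinuousLinearEquiv.symm_apply_apply] at hz ⊢
    exact ⟨f.mapsTo hz.1, hz.2⟩

theorem mapsTo_prodMap_iff {k l : ℕ} {F : (Fin k → ℝ) → (Fin l → ℝ)} {z : Fin (k + 1) → ℝ}
    {B : Set (Fin l → ℝ)} {T : Set ℝ} :
    prodMap F z ∈ prodStratum B T ↔
      F ((snocEquiv k).symm z).1 ∈ B ∧ ((snocEquiv k).symm z).2 ∈ T := by
  simp [prodStratum, prodMap]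

theorem IsStratified.prodI {k l : ℕ} {X : StratSpace k} {Y : StratSpace l}
    {F : (Fin k → ℝ) → (Fin l → ℝ)} (hF : ContDiff ℝ ∞ F) (h : IsStratified X Y F) :
    IsStratified X.prodI Y.prodI (prodMap F) := by
  rintro _ ⟨B, hB, T, hT, rfl⟩ _ ⟨A, hA, S, hS, rfl⟩ ⟨z, hz, hz'⟩
  rw [mem_preimage, mapsTo_prodMap_iff] at hz'
  obtain ⟨h1, h2⟩ := h B hB A hA ⟨_, hz.1, hz'.1⟩
  have hST : S = T := by
    by_contra hne
    exact Set.disjoint_left.1 (disjoint_intervalStrata hS hT hne) hz.2 hz'.2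
  subst hST
  refine ⟨fun y hy => mapsTo_prodMap_iff.2 ⟨h1 hy.1, hy.2⟩, fun y hy => ?_⟩
  set p := (snocEquiv k).symm y with hp
  have hd : HasFDerivAt (prodMap F) ((snocEquiv l : _ →L[ℝ] _).comp
      (((fderiv ℝ F p.1).prodMap (ContinuousLinearMap.id ℝ ℝ)).comp
        ((snocEquiv k).symm : _ →L[ℝ] _))) y := by
    refine (snocEquiv l).hasFDerivAt.comp y (HasFDerivAt.comp y ?_ (snocEquiv k).symm.hasFDerivAt)
    exact HasFDerivAt.prodMap p
      ((hF.differentiable (by simp) p.1).hasFDerivAt) (hasFDerivAt_id p.2)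
  have hpp : ((snocEquiv l).symm (prodMap F y)) = (F p.1, p.2) := by
    simp only [prodMap, Function.comp, ContinuousLinearEquiv.symm_apply_apply, hp]
    rfl
  rw [hd.fderiv]
  unfold prodStratum
  rw [tangentSpace_preimage, tangentSpace_preimage, hpp,
    tangentSpace_prod (show F p.1 ∈ B from h1 hy.1) hy.2, ← hp,
    show tangentSpace (A ×ˢ S) p = (tangentSpace A p.1).prod (tangentSpace S p.2) from tangentSpace_prod hy.1 hy.2, ← h2 p.1 hy.1]
  clear_value p
  ext w
  constructor
  · rintro ⟨v, ⟨hv1, hv2⟩, rfl⟩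
    simp only [Submodule.mem_comap]
    constructor
    · refine ⟨_, hv1, ?_⟩
      simp
    · simpa using hv2
  · rintro ⟨⟨v, hv, hv'⟩, hw2⟩
    refine ⟨snocEquiv k (v, ((snocEquiv l).symm w).2), ⟨?_, ?_⟩, ?_⟩
    · simpa using hv
    · simpa using hw2
    · have : w = snocEquiv l (((snocEquiv l).symm w).1, ((snocEquiv l).symm w).2) := by simp
      have hv'' : fderiv ℝ F p.1 v = ((snocEquiv l).symm w).1 := hv'
      rw [this, ← hv'']
      simp

theorem IsPrestratified.prodI {k l : ℕ} {X : StratSpace k} {Y : StratSpace l}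
    {F : (Fin k → ℝ) → (Fin l → ℝ)} (hF : ContDiff ℝ ∞ F) (h : IsPrestratified X Y F) :
    IsPrestratified X.prodI Y.prodI (prodMap F) := by
  obtain ⟨X', ⟨hc, hs⟩, h'⟩ := h
  refine ⟨X'.prodI, ⟨?_, ?_⟩, h'.prodI hF⟩
  · rw [StratSpace.carrier_prodI, StratSpace.carrier_prodI, hc]
  · rintro _ ⟨A', hA', T, hT, rfl⟩
    obtain ⟨A, hA, hAA⟩ := hs A' hA'
    exact ⟨_, ⟨A, hA, T, hT, rfl⟩, preimage_mono (prod_mono hAA subset_rfl)⟩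

/-- The functor `X ↦ X × [0,1]` for smooth maps. -/
noncomputable def prodISmooth (n : ℕ) : CellSpace n ⥤ CellSpace (n + 1) where
  obj X := X.prodI
  map f := SmoothMap.prodI f
  map_id X := by
    apply SmoothMap.ext
    funext z
    exact (snocEquiv X.k).apply_symm_apply z
  map_comp f g := by
    apply SmoothMap.ext
    funext z
    change snocEquiv _ _ = snocEquiv _ (Prod.map _ id ((snocEquiv _).symm (snocEquiv _ _)))
    rw [ContinuousLinearEquiv.symm_apply_apply]
    rfl

/-- The inclusion of spaces of dimension `≤ n` in those of dimension `≤ n + 1`. -/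
def inclSmooth (n : ℕ) : CellSpace n ⥤ CellSpace (n + 1) where
  obj X := X.incl
  map {X Y} f :=
    (⟨SmoothMap.toFun (X := X) (Y := Y) f, SmoothMap.contDiff (X := X) (Y := Y) f,
      SmoothMap.mapsTo (X := X) (Y := Y) f⟩ : SmoothMap X.incl Y.incl)

theorem map_multiplicativeClosure {C D : Type*} [Category* C] [Category* D]
    (W : MorphismProperty C) (W' : MorphismProperty D) (Φ : C ⥤ D)
    (h : ∀ ⦃X Y : C⦄ (f : X ⟶ Y), W f → W' (Φ.map f)) {X Y : C} {f : X ⟶ Y}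
    (hf : W.multiplicativeClosure f) : W'.multiplicativeClosure (Φ.map f) := by
  induction hf with
  | of f hf => exact .of _ (h f hf)
  | id X => rw [Φ.map_id]; exact .id _
  | comp_of f g hf hg ih => rw [Φ.map_comp]; exact .comp_of _ _ ih (h g hg)

/-- A functor that preserves a class of maps preserves the composites of such maps. -/
def liftClosure {C D : Type*} [Category* C] [Category* D] (W : MorphismProperty C)
    (W' : MorphismProperty D) (Φ : C ⥤ D) (h : ∀ ⦃X Y : C⦄ (f : X ⟶ Y), W f → W' (Φ.map f)) :
    WideSubcategory W.multiplicativeClosure ⥤ WideSubcategory W'.multiplicativeClosure where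
  obj X := ⟨Φ.obj X.obj⟩
  map f := ⟨Φ.map f.hom, by
    exact map_multiplicativeClosure W W' Φ h f.property⟩
  map_id X := by ext; exact Φ.map_id _
  map_comp f g := by ext; exact Φ.map_comp _ _

/-- The functor `X ↦ X × [0,1]`, `f ↦ f × id`. -/
noncomputable def prodI (n : ℕ) : PrestratMaps n ⥤ PrestratMaps (n + 1) :=
  liftClosure (prestratified n) (prestratified (n + 1)) (prodISmooth n) fun _ _ f hf =>
    IsPrestratified.prodI (SmoothMap.contDiff f) hf

/-- The inclusion of spaces of dimension `≤ n` in those of dimension `≤ n + 1`. -/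
def incl (n : ℕ) : PrestratMaps n ⥤ PrestratMaps (n + 1) :=
  liftClosure (prestratified n) (prestratified (n + 1)) (inclSmooth n) fun _ _ _ hf => hf

/-- The point. -/
def pt (n : ℕ) : PrestratMaps n := ⟨.pt n⟩

theorem isStratified_toPt {k : ℕ} (X : StratSpace k) :
    IsStratified X .pt (fun _ => (0 : Fin 0 → ℝ)) := by
  rintro _ rfl A hA -
  exact ⟨fun _ _ => trivial, fun x _ => Subsingleton.elim _ _⟩

/-- The map to the point. -/
def toPt {n : ℕ} (X : PrestratMaps n) : X ⟶ pt n where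
  hom := (⟨fun _ => (0 : Fin 0 → ℝ), contDiff_const, fun _ _ => ⟨univ, rfl, trivial⟩⟩ :
    SmoothMap X.obj (CellSpace.pt n))
  property := .of _ (isStratified_toPt X.obj.space).isPrestratified

theorem isStratified_endpoint {k : ℕ} (X : StratSpace k) {t : ℝ} (ht : t = 0 ∨ t = 1) :
    IsStratified X X.prodI (fun x => snocEquiv k (x, t)) := by
  rintro _ ⟨B, hB, T, hT, rfl⟩ A hA ⟨x, hxA, hxB⟩
  have hmem : ∀ y S, snocEquiv k (y, t) ∈ prodStratum B S ↔ y ∈ B ∧ t ∈ S := fun y S => by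
    simp [prodStratum]
  rw [mem_preimage, hmem] at hxB
  have hAB : A = B := by
    by_contra hne
    exact Set.disjoint_left.1 (X.disjoint A hA B hB hne) hxA hxB.1
  subst hAB
  have hTt : T = {t} := by
    by_contra hne
    refine Set.disjoint_left.1 (disjoint_intervalStrata hT ?_ hne) hxB.2 rfl
    rcases ht with rfl | rfl <;> simp [intervalStrata]
  subst hTt
  refine ⟨fun y hy => (hmem y _).2 ⟨hy, rfl⟩, fun y hy => ?_⟩
  have hd : HasFDerivAt (fun x => snocEquiv k (x, t))
      ((snocEquiv k : _ →L[ℝ] _).comp (ContinuousLinearMap.inl ℝ (Fin k → ℝ) ℝ)) y :=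
    (snocEquiv k).hasFDerivAt.comp y (hasFDerivAt_prodMk_left y t)
  rw [hd.fderiv]
  unfold prodStratum
  rw [tangentSpace_preimage, ContinuousLinearEquiv.symm_apply_apply,
    tangentSpace_prod hy (mem_singleton t), tangentSpace_singleton]
  ext w
  constructor
  · rintro ⟨v, hv, rfl⟩
    simpa using hv
  · rintro ⟨hw1, hw2⟩
    refine ⟨_, hw1, ?_⟩
    have hw : w = snocEquiv _ (((snocEquiv _).symm w).1, ((snocEquiv _).symm w).2) := by simp
    have hw2' : ((snocEquiv k).symm w).2 = 0 := by simpa using hw2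
    conv_rhs => rw [hw, hw2']
    simp

/-- The inclusion `X = X × {t} → X × [0,1]` of an end, `t ∈ {0, 1}`. -/
noncomputable def endpoint {n : ℕ} (t : ℝ) (ht : t = 0 ∨ t = 1) (X : PrestratMaps n) :
    (incl n).obj X ⟶ (prodI n).obj X where
  hom := (⟨fun x => snocEquiv X.obj.k (x, t),
    (snocEquiv X.obj.k).contDiff.comp (contDiff_id.prodMk contDiff_const), fun x hx => by
      change _ ∈ X.obj.space.prodI.carrier
      rw [StratSpace.carrier_prodI]
      have : t ∈ Icc (0 : ℝ) 1 := by rcases ht with rfl | rfl <;> simp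
      simp only [prodStratum, mem_preimage, ContinuousLinearEquiv.symm_apply_apply]
      exact ⟨hx, this⟩⟩ : SmoothMap X.obj.incl X.obj.prodI)
  property := .of _ (isStratified_endpoint X.obj.space ht).isPrestratified

theorem endpoint_naturality {n : ℕ} (t : ℝ) (ht : t = 0 ∨ t = 1) {X Y : PrestratMaps n}
    (f : X ⟶ Y) :
    (incl n).map f ≫ endpoint t ht Y = endpoint t ht X ≫ (prodI n).map f := by
  ext
  apply SmoothMap.ext
  funext x
  change snocEquiv _ _ = snocEquiv _ (Prod.map _ id ((snocEquiv _).symm (snocEquiv _ _)))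
  rw [ContinuousLinearEquiv.symm_apply_apply]
  rfl

theorem toPt_naturality {n : ℕ} {X Y : PrestratMaps n} (f : X ⟶ Y) :
    f ≫ toPt Y = toPt X := by
  ext
  rfl

/-! ### Morphism categories and `n`-equivalence -/

/-- The presheaf of morphisms from `a` to `a'`,
`X ↦ {α ∈ A(X × [0,1]) | ι₀^* α = p^* a, ι₁^* α = p^* a'}` where `p : X → pt`. -/
noncomputable def homPresheaf {n : ℕ} (A : (PrestratMaps (n + 1))ᵒᵖ ⥤ Type u)
    (a a' : A.obj (op (pt (n + 1)))) : (PrestratMaps n)ᵒᵖ ⥤ Type u where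
  obj X := {α : A.obj (op ((prodI n).obj X.unop)) //
    A.map (endpoint 0 (Or.inl rfl) X.unop).op α = A.map (toPt ((incl n).obj X.unop)).op a ∧
    A.map (endpoint 1 (Or.inr rfl) X.unop).op α = A.map (toPt ((incl n).obj X.unop)).op a'}
  map {X Y} f := TypeCat.ofHom fun α => ⟨A.map ((prodI n).map f.unop).op α.1, by
    have key : ∀ (t : ℝ) (ht : t = 0 ∨ t = 1) (b : A.obj (op (pt (n + 1)))),
        A.map (endpoint t ht X.unop).op α.1 = A.map (toPt ((incl n).obj X.unop)).op b →
        A.map (endpoint t ht Y.unop).op (A.map ((prodI n).map f.unop).op α.1) =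
          A.map (toPt ((incl n).obj Y.unop)).op b := by
      intro t ht b hb
      rw [← CategoryTheory.Functor.map_comp_apply, ← op_comp, ← endpoint_naturality, op_comp,
        CategoryTheory.Functor.map_comp_apply, hb, ← CategoryTheory.Functor.map_comp_apply, ← op_comp,
        toPt_naturality]
    exact ⟨key 0 _ a α.2.1, key 1 _ a' α.2.2⟩⟩
  map_id X := by
    ext α
    change A.map ((prodI n).map (𝟙 X.unop)).op α.1 = α.1
    simp
  map_comp f g := by
    ext α
    change A.map ((prodI n).map (g.unop ≫ f.unop)).op α.1 =
      A.map ((prodI n).map g.unop).op (A.map ((prodI n).map f.unop).op α.1)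
    simp

/-- The map `A(a, a') → B(F a, F a')` induced by `F : A → B`. -/
noncomputable def homPresheafMap {n : ℕ} {A B : (PrestratMaps (n + 1))ᵒᵖ ⥤ Type u} (F : A ⟶ B)
    (a a' : A.obj (op (pt (n + 1)))) :
    homPresheaf A a a' ⟶ homPresheaf B (F.app _ a) (F.app _ a') where
  app X := TypeCat.ofHom fun α => ⟨F.app _ α.1, by
    rw [← NatTrans.naturality_apply, ← NatTrans.naturality_apply, ← NatTrans.naturality_apply,
      ← NatTrans.naturality_apply, α.2.1, α.2.2]
    exact ⟨rfl, rfl⟩⟩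
  naturality X Y f := by
    ext α
    refine Subtype.ext ?_
    exact NatTrans.naturality_apply F _ _

/-- The inductive notion of `n`-equivalence for a span `A ← C → B`. It involves only the underlying
presheaves on prestratified maps. -/
def IsNEquivalence : (n : ℕ) → {A B C : (PrestratMaps n)ᵒᵖ ⥤ Type u} → (C ⟶ A) → (C ⟶ B) → Prop
  | 0, _, _, _, F, G =>
    Function.Bijective (F.app (op (pt 0))) ∧ Function.Bijective (G.app (op (pt 0)))
  | n + 1, _, _, C, F, G =>
    Function.Surjective (F.app (op (pt (n + 1)))) ∧
    Function.Surjective (G.app (op (pt (n + 1)))) ∧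
    ∀ c c' : C.obj (op (pt (n + 1))),
      IsNEquivalence n (homPresheafMap F c c') (homPresheafMap G c c')

/-- The presheaf on prestratified maps underlying a Whitney category. -/
def WhitneyCategory.presheaf {n : ℕ} (A : WhitneyCategory.{u} n) :
    (PrestratMaps n)ᵒᵖ ⥤ Type u :=
  (CategoryTheory.Quotient.functor (prestratHomotopy n)).op ⋙ A.obj

/-- The map of underlying presheaves given by a functor of Whitney categories. -/
def WhitneyCategory.presheafMap {n : ℕ} {A B : WhitneyCategory.{u} n} (F : A ⟶ B) :
    A.presheaf ⟶ B.presheaf :=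
  Functor.whiskerLeft (CategoryTheory.Quotient.functor (prestratHomotopy n)).op F.hom

/-- Whitney `n`-categories `A` and `B` are `n`-equivalent: there is an `n`-equivalence, i.e. a span
`A ← C → B` of functors of Whitney `n`-categories which is an `n`-equivalence. -/
def NEquivalent (n : ℕ) (A B : WhitneyCategory.{u} n) : Prop :=
  ∃ (C : WhitneyCategory.{u} n) (F : C ⟶ A) (G : C ⟶ B),
    IsNEquivalence n (WhitneyCategory.presheafMap F) (WhitneyCategory.presheafMap G)

end WhitneyStrat

/-! Reflexivity is witnessed by the span of two identities, and symmetry by exchanging the two legs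
of a span. The content is transitivity. Given `n`-equivalences `A ← C → B` and `B ← D → E`, the apex
of the composite span is the fibre product `P = C ×_B D`, formed objectwise.

It is again a Whitney category because a fibre product of sheaves is a sheaf: the two components of
a matching family are glued separately, and the glued sections agree in `B` because sections of `B`
are determined locally (`IsPointwisePullback.isSheafFor`).

The legs of `P` form an `n`-equivalence by induction on `n` (`IsNEquivalence.comp`). Surjections and
bijections are stable under base change, which settles the objects. For morphisms, taking morphism
presheaves commutes with fibre products: for `x = (c, d)` and `x' = (c', d')` one has `P(x, x') =
C(c, c') ×_{B(b, b')} D(d, d')` with `b = Gc = Hd` and `b' = Gc' = Hd'`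
(`IsPointwisePullback.homPresheaf`), so the inductive hypothesis applies. The induction concerns
bare presheaves on prestratified maps; morphism presheaves never have to be sheaves.

One technical point shapes the statements. Since `Gc = Hd` is only a propositional equality, the
presheaves `B(Gc, Gc')` and `B(Hd, Hd')` are different types. The induction therefore allows the
middle terms of the two spans to differ by an objectwise bijective map `e : B ⟶ B'`, and
`homPresheafMapOfEq` absorbs the transport. -/

namespace WhitneyStrat

/-! ### Induced maps of morphism presheaves, with prescribed end objects -/

/-- The map `A(a, a') → B(b, b')` induced by `F : A → B` when `F a = b` and `F a' = b'`. -/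
noncomputable def homPresheafMapOfEq {n : ℕ} {A B : (PrestratMaps (n + 1))ᵒᵖ ⥤ Type u} (F : A ⟶ B)
    {a a' : A.obj (op (pt (n + 1)))} {b b' : B.obj (op (pt (n + 1)))}
    (h : F.app _ a = b) (h' : F.app _ a' = b') : homPresheaf A a a' ⟶ homPresheaf B b b' where
  app X := TypeCat.ofHom fun α => ⟨F.app _ α.1, by
    -- By naturality the ends of `F α` are the images under `F` of the constant families at `a` and
    -- `a'`, hence the constant families at `F a = b` and `F a' = b'`.
    rw [← NatTrans.naturality_apply, ← NatTrans.naturality_apply, α.2.1, α.2.2,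
      NatTrans.naturality_apply, NatTrans.naturality_apply, h, h']
    exact ⟨rfl, rfl⟩⟩
  naturality X Y f := by
    ext α
    exact Subtype.ext (NatTrans.naturality_apply F _ _)

/-- A pointwise bijective map of presheaves induces pointwise bijective maps of morphism
presheaves. -/
theorem bijective_homPresheafMapOfEq {n : ℕ} {A B : (PrestratMaps (n + 1))ᵒᵖ ⥤ Type u} {F : A ⟶ B}
    (hF : ∀ X, Function.Bijective (F.app X))
    {a a' : A.obj (op (pt (n + 1)))} {b b' : B.obj (op (pt (n + 1)))}
    (h : F.app _ a = b) (h' : F.app _ a' = b') (X : (PrestratMaps n)ᵒᵖ) :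
    Function.Bijective ((homPresheafMapOfEq F h h').app X) := by
  subst h h'
  constructor
  · intro α β hαβ
    exact Subtype.ext ((hF _).1 (congrArg Subtype.val hαβ))
  · rintro ⟨β, h0, h1⟩
    obtain ⟨α, rfl⟩ := (hF _).2 β
    -- The boundary conditions on the lift `α` may be tested after applying the injective map `F`,
    -- where they become those of `β`.
    refine ⟨⟨α, (hF _).1 ?_, (hF _).1 ?_⟩, Subtype.ext rfl⟩
    · rw [NatTrans.naturality_apply, NatTrans.naturality_apply]; exact h0
    · rw [NatTrans.naturality_apply, NatTrans.naturality_apply]; exact h1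

/-! ### Bijective spans and reversed spans -/

/-- Gives reflexivity when applied to identities. Bijectivity at every object, not only at the
point, is what passes to morphism presheaves and lets the induction close. -/
theorem IsNEquivalence.of_bijective : ∀ (n : ℕ) {A B C : (PrestratMaps n)ᵒᵖ ⥤ Type u}
    {F : C ⟶ A} {G : C ⟶ B}, (∀ X, Function.Bijective (F.app X)) →
    (∀ X, Function.Bijective (G.app X)) → IsNEquivalence n F G
  | 0, _, _, _, _, _, hF, hG => ⟨hF _, hG _⟩
  | n + 1, _, _, _, _, _, hF, hG => ⟨(hF _).2, (hG _).2, fun _ _ =>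
      -- With `rfl` for both equations, `homPresheafMapOfEq` is definitionally `homPresheafMap`.
      of_bijective n (bijective_homPresheafMapOfEq hF rfl rfl)
        (bijective_homPresheafMapOfEq hG rfl rfl)⟩

theorem IsNEquivalence.symm : ∀ (n : ℕ) {A B C : (PrestratMaps n)ᵒᵖ ⥤ Type u}
    {F : C ⟶ A} {G : C ⟶ B}, IsNEquivalence n F G → IsNEquivalence n G F
  | 0, _, _, _, _, _, h => ⟨h.2, h.1⟩
  | n + 1, _, _, _, _, _, h => ⟨h.2.1, h.1, fun c c' => symm n (h.2.2 c c')⟩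

/-! ### Pointwise pullbacks and composition of spans -/

/-- The square formed by `p : P → C`, `q : P → D`, `G : C → B` and `H : D → B` is a pullback of
sets at each object. -/
structure IsPointwisePullback {J : Type*} [Category* J] {P C D B : J ⥤ Type u} (p : P ⟶ C)
    (q : P ⟶ D) (G : C ⟶ B) (H : D ⟶ B) : Prop where
  comm (X : J) (x : P.obj X) : G.app X (p.app X x) = H.app X (q.app X x)
  ext (X : J) (x y : P.obj X) : p.app X x = p.app X y → q.app X x = q.app X y → x = y
  exists_lift (X : J) (c : C.obj X) (d : D.obj X) :
    G.app X c = H.app X d → ∃ x, p.app X x = c ∧ q.app X x = d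

/-- Morphism presheaves of a pullback form a pullback. -/
theorem IsPointwisePullback.homPresheaf {n : ℕ} {P C D B : (PrestratMaps (n + 1))ᵒᵖ ⥤ Type u}
    {p : P ⟶ C} {q : P ⟶ D} {G : C ⟶ B} {H : D ⟶ B} (h : IsPointwisePullback p q G H)
    (x x' : P.obj (op (pt (n + 1)))) :
    IsPointwisePullback (homPresheafMap p x x') (homPresheafMap q x x')
      (homPresheafMapOfEq G (h.comm _ x) (h.comm _ x'))
      (homPresheafMap H (q.app _ x) (q.app _ x')) where
  comm X α := Subtype.ext (h.comm _ α.1)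
  ext X α β h1 h2 :=
    Subtype.ext (h.ext _ _ _ (congrArg Subtype.val h1) (congrArg Subtype.val h2))
  exists_lift X := by
    rintro ⟨γ, hγ⟩ ⟨δ, hδ⟩ hγδ
    obtain ⟨α, rfl, rfl⟩ := h.exists_lift _ γ δ (congrArg Subtype.val hγδ)
    -- The two projections of `P` are jointly injective, so each boundary condition on `α` splits
    -- into the known ones for `γ` and `δ`.
    refine ⟨⟨α, h.ext _ _ _ ?_ ?_, h.ext _ _ _ ?_ ?_⟩, Subtype.ext rfl, Subtype.ext rfl⟩
    · rw [NatTrans.naturality_apply, NatTrans.naturality_apply]; exact hγ.1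
    · rw [NatTrans.naturality_apply, NatTrans.naturality_apply]; exact hδ.1
    · rw [NatTrans.naturality_apply, NatTrans.naturality_apply]; exact hγ.2
    · rw [NatTrans.naturality_apply, NatTrans.naturality_apply]; exact hδ.2

/-- Spans `A ← C → B` and `B' ← D → E` that are `n`-equivalences can be composed along a pointwise
bijective map `B → B'`, by means of the pullback. -/
theorem IsNEquivalence.comp : ∀ (n : ℕ) {A B B' C D E P : (PrestratMaps n)ᵒᵖ ⥤ Type u}
    {F : C ⟶ A} {G : C ⟶ B} {H : D ⟶ B'} {K : D ⟶ E} {p : P ⟶ C} {q : P ⟶ D} {e : B ⟶ B'},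
    IsNEquivalence n F G → IsNEquivalence n H K → (∀ X, Function.Bijective (e.app X)) →
    IsPointwisePullback p q (G ≫ e) H → IsNEquivalence n (p ≫ F) (q ≫ K)
  | 0, _, _, _, _, _, _, _, F, G, H, K, p, q, e, h, h', he, hP => by
    -- At the point, `p` is the base change of the bijection `H`.
    have hp : Function.Bijective (p.app (op (pt 0))) := by
      constructor
      · intro x y hxy
        refine hP.ext _ _ _ hxy (h'.1.1 ?_)
        rw [← hP.comm, ← hP.comm, hxy]
      · intro c
        obtain ⟨d, hd⟩ := h'.1.2 ((G ≫ e).app _ c)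
        obtain ⟨x, hx, -⟩ := hP.exists_lift _ c d hd.symm
        exact ⟨x, hx⟩
    have hGe : Function.Bijective ((G ≫ e).app (op (pt 0))) := (he _).comp h.2
    -- Likewise `q` is the base change of the bijection `G ≫ e`.
    have hq : Function.Bijective (q.app (op (pt 0))) := by
      constructor
      · intro x y hxy
        refine hP.ext _ _ _ (hGe.1 ?_) hxy
        rw [hP.comm, hP.comm, hxy]
      · intro d
        obtain ⟨c, hc⟩ := hGe.2 (H.app _ d)
        obtain ⟨x, -, hx⟩ := hP.exists_lift _ c d hc
        exact ⟨x, hx⟩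
    exact ⟨h.1.comp hp, h'.2.comp hq⟩
  | n + 1, _, _, _, _, _, _, _, F, G, H, K, p, q, e, h, h', he, hP => by
    refine ⟨fun a => ?_, fun b => ?_, fun x x' => ?_⟩
    · obtain ⟨c, rfl⟩ := h.1 a
      -- Surjectivity of `H` on objects supplies a partner `d` for `c` in the fibre product.
      obtain ⟨d, hd⟩ := h'.1 ((G ≫ e).app _ c)
      obtain ⟨x, rfl, -⟩ := hP.exists_lift _ c d hd.symm
      exact ⟨x, rfl⟩
    · obtain ⟨d, rfl⟩ := h'.2.1 b
      -- `G` is surjective onto the objects of `B`, not of `B'`, so `H d` is first pulled back along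
      -- `e`.
      obtain ⟨b, hb⟩ := (he _).2 (H.app _ d)
      obtain ⟨c, rfl⟩ := h.2.1 b
      obtain ⟨x, -, rfl⟩ := hP.exists_lift _ c d hb
      exact ⟨x, rfl⟩
    · exact comp n (h.2.2 (p.app _ x) (p.app _ x')) (h'.2.2 (q.app _ x) (q.app _ x'))
        (bijective_homPresheafMapOfEq he (hP.comm _ x) (hP.comm _ x')) (hP.homPresheaf x x')

/-! ### The fibre product of set-valued functors -/

section Pullback

variable {J : Type*} [Category* J] {C D B : J ⥤ Type u} (G : C ⟶ B) (H : D ⟶ B)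

/-- The pullback of functors to sets, as pairs of elements with the same image. -/
def pullbackFunctor : J ⥤ Type u where
  obj X := {z : C.obj X × D.obj X // G.app X z.1 = H.app X z.2}
  map f := TypeCat.ofHom fun z => ⟨(C.map f z.1.1, D.map f z.1.2), by
    rw [NatTrans.naturality_apply, NatTrans.naturality_apply, z.2]⟩
  map_id X := by
    refine TypeCat.homEquiv.injective (funext fun z => Subtype.ext (Prod.ext ?_ ?_))
    · change C.map (𝟙 X) z.1.1 = z.1.1
      simp
    · change D.map (𝟙 X) z.1.2 = z.1.2
      simp
  map_comp f g := by
    refine TypeCat.homEquiv.injective (funext fun z => Subtype.ext (Prod.ext ?_ ?_))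
    · change C.map (f ≫ g) z.1.1 = C.map g (C.map f z.1.1)
      simp
    · change D.map (f ≫ g) z.1.2 = D.map g (D.map f z.1.2)
      simp

/-- The first projection of the pullback. -/
def pullbackFst : pullbackFunctor G H ⟶ C where
  app _ := TypeCat.ofHom fun z => z.1.1

/-- The second projection of the pullback. -/
def pullbackSnd : pullbackFunctor G H ⟶ D where
  app _ := TypeCat.ofHom fun z => z.1.2

theorem isPointwisePullback_pullbackFunctor :
    IsPointwisePullback (pullbackFst G H) (pullbackSnd G H) G H where
  comm _ z := z.2
  ext _ _ _ h1 h2 := Subtype.ext (Prod.ext h1 h2)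
  exists_lift _ c d h := ⟨⟨(c, d), h⟩, rfl, rfl⟩

end Pullback

/-! ### The sheaf condition for fibre products -/

/-- A pullback of sheaves is a sheaf. -/
theorem IsPointwisePullback.isSheafFor {J : Type*} [Category* J] {P C D B : Jᵒᵖ ⥤ Type u}
    {p : P ⟶ C} {q : P ⟶ D} {G : C ⟶ B} {H : D ⟶ B} (h : IsPointwisePullback p q G H)
    {X : J} {R : Presieve X} (hC : R.IsSheafFor C) (hD : R.IsSheafFor D)
    (hB : R.IsSeparatedFor B) : R.IsSheafFor P := by
  intro x hx
  obtain ⟨c, hc, hc'⟩ := hC (Presieve.FamilyOfElements.map x p) (Presieve.FamilyOfElements.Compatible.map p hx)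
  obtain ⟨d, hd, hd'⟩ := hD (Presieve.FamilyOfElements.map x q) (Presieve.FamilyOfElements.Compatible.map q hx)
  -- Both sides restrict along each `f` of `R` to the common image in `B` of the given family, so
  -- separatedness of `B` suffices.
  have hcd : G.app _ c = H.app _ d := by
    refine hB.ext fun Y f hf => ?_
    rw [← NatTrans.naturality_apply, ← NatTrans.naturality_apply, hc f hf, hd f hf]
    exact h.comm _ _
  obtain ⟨z, rfl, rfl⟩ := h.exists_lift _ c d hcd
  -- That `z` is an amalgamation, and the only one, is checked on its two projections.
  refine ⟨z, fun Y f hf => h.ext _ _ _ ?_ ?_, fun y hy => h.ext _ _ _ (hc' _ ?_) (hd' _ ?_)⟩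
  · rw [NatTrans.naturality_apply]; exact hc f hf
  · rw [NatTrans.naturality_apply]; exact hd f hf
  · exact Presieve.FamilyOfElements.IsAmalgamation.map p hy
  · exact Presieve.FamilyOfElements.IsAmalgamation.map q hy

/-- The pullback of Whitney categories. -/
def WhitneyCategory.pullback {n : ℕ} {B C D : WhitneyCategory.{u} n} (G : C ⟶ B) (H : D ⟶ B) :
    WhitneyCategory.{u} n where
  obj := pullbackFunctor G.hom H.hom
  property X S hS := by
    have h := isPointwisePullback_pullbackFunctor G.hom H.hom
    -- A pointwise condition survives precomposition with any functor, here the restriction to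
    -- stratified maps on which the sheaf condition is imposed.
    have h' : IsPointwisePullback
        (Functor.whiskerLeft (stratToPrestrat n).op (pullbackFst G.hom H.hom))
        (Functor.whiskerLeft (stratToPrestrat n).op (pullbackSnd G.hom H.hom))
        (Functor.whiskerLeft (stratToPrestrat n).op G.hom)
        (Functor.whiskerLeft (stratToPrestrat n).op H.hom) :=
      ⟨fun _ => h.comm _, fun _ => h.ext _, fun _ => h.exists_lift _⟩
    exact h'.isSheafFor (C.property X S hS) (D.property X S hS) (B.property X S hS).isSeparatedFor

/-! ### The three properties of an equivalence relation -/

theorem NEquivalent.refl {n : ℕ} (A : WhitneyCategory.{u} n) : NEquivalent n A A :=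
  ⟨A, 𝟙 A, 𝟙 A, .of_bijective n (fun _ => Function.bijective_id) fun _ => Function.bijective_id⟩

theorem NEquivalent.symm {n : ℕ} {A B : WhitneyCategory.{u} n} :
    NEquivalent n A B → NEquivalent n B A :=
  fun ⟨C, F, G, h⟩ => ⟨C, G, F, h.symm⟩

/-- Composition of spans by fibre product over the shared middle term `B`. -/
theorem NEquivalent.trans {n : ℕ} {A B E : WhitneyCategory.{u} n} :
    NEquivalent n A B → NEquivalent n B E → NEquivalent n A E := by
  rintro ⟨C, F, G, h⟩ ⟨D, H, K, h'⟩
  have hP := isPointwisePullback_pullbackFunctor G.hom H.hom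
  let p : WhitneyCategory.pullback G H ⟶ C := ⟨pullbackFst G.hom H.hom⟩
  let q : WhitneyCategory.pullback G H ⟶ D := ⟨pullbackSnd G.hom H.hom⟩
  -- At the top level both spans share the same `B`, so `e` starts as the identity. The final
  -- component is the pullback property after passing from homotopy classes to maps, again by
  -- precomposition.
  exact ⟨WhitneyCategory.pullback G H, p ≫ F, q ≫ K,
    IsNEquivalence.comp n (p := WhitneyCategory.presheafMap p)
      (q := WhitneyCategory.presheafMap q) (e := 𝟙 B.presheaf) h h'
      (fun _ => Function.bijective_id)
      ⟨fun _ => hP.comm _, fun _ => hP.ext _, fun _ => hP.exists_lift _⟩⟩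

end WhitneyStrat

theorem mainTheorem9 (n : ℕ) : Equivalence (WhitneyStrat.NEquivalent.{u} n) :=
  ⟨WhitneyStrat.NEquivalent.refl, WhitneyStrat.NEquivalent.symm, WhitneyStrat.NEquivalent.trans⟩
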